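/- Let $V=\{1,\dots,p\}$ and let $F:2^V\to\mathbb{R}$ be non-negative and submodular with $F(\varnothing)=F(V)=0$. Let $f(w)=\int_{\mathbb{R}}F(\{w\ge\alpha\})\,d\alpha$ be its Lovász extension and $B(F)=\{s\in\mathbb{R}^p:\ s(A)\le F(A)\ \forall A\subset V,\ s(V)=F(V)\}$ its base polyhedron, where $s(A)=\sum_{k\in A}s_k$. A set $A$ is called separable for a set-function $G$ if $A$ is the disjoint union of two non-empty sets $B,C$ with $G(A)=G(B)+G(C)$, and inseparable otherwise. For $w\in\mathbb{R}^p$, the lattice $\mathcal{D}(w)$ associated to $w$ consists of the sets $A$ such that $s(A)=F(A)$ for every $s$ in the face $\operatorname{argmax}_{s\in B(F)}w^\top s$. The constant sets of $w$ are the elements of the partition of $V$ defined by $\mathcal{D}(w)$: two indices $i,j$ are in the same constant set if and only if every $A\in\mathcal{D}(w)$ contains both or neither of them. (The variable $w$ takes a single value on each of them.) Suppose that for all $A,B\subset V$ with $A\cap B=\varnothing$ and $A$ inseparable for $D\mapsto F(B\cup D)-F(B)$, $$\forall C\subset A,\qquad \frac{|C|}{|A|}\,[F(B\cup A)-F(B)]\le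 F(B\cup C)-F(B).$$ Let $z\in\mathbb{R}^p$. Then for every $\lambda\ge 0$ the proximal problem $\min_{w\in\mathbb{R}^p}\frac12\|w-z\|_2^2+\lambda f(w)$ has a unique solution $w^\lambda$, and the regularization path $\lambda\mapsto w^\lambda$ is agglomerative: if two variables are in the same constant set of $w^\mu$ for some $\mu\ge 0$, then for all $\lambda\ge\mu$ they are in the same constant set of $w^\lambda$, and in particular $w^\lambda_i=w^\lambda_j$. The same conclusion holds for any two variables in a set $\{w^\mu=\alpha\}$ that is inseparable for $D\mapsto F(\{w^\mu>\alpha\}\cup D)-F(\{w^\mu>\alpha\})$. -/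

import Mathlib

/-- `F(A) + F(B) ≥ F(A ∪ B) + F(A ∩ B)` for all subsets `A`, `B` of the ground set. -/
def IsSubmodular {p : ℕ} (F : Finset (Fin p) → ℝ) : Prop :=
  ∀ A B : Finset (Fin p), F (A ∪ B) + F (A ∩ B) ≤ F A + F B

/-- `A` is separable for `G` if `A = B ∪ C` is a partition into two nonempty sets with
`G A = G B + G C`. -/
def IsSeparableSet {p : ℕ} (G : Finset (Fin p) → ℝ) (A : Finset (Fin p)) : Prop :=
  ∃ B C : Finset (Fin p), B.Nonempty ∧ C.Nonempty ∧ Disjoint B C ∧ B ∪ C = A ∧ G A = G B + G C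

/-- The set-function `D ↦ F(B ∪ D) - F(B)`. -/
def contraction {p : ℕ} (F : Finset (Fin p) → ℝ) (B : Finset (Fin p)) : Finset (Fin p) → ℝ :=
  fun D => F (B ∪ D) - F B

/-- The level set `{w ≥ α}`. -/
noncomputable def levelSet {p : ℕ} (w : EuclideanSpace ℝ (Fin p)) (α : ℝ) : Finset (Fin p) :=
  Finset.univ.filter (fun k => α ≤ w k)

/-- The set `{w > α}`. -/
noncomputable def strictLevelSet {p : ℕ} (w : EuclideanSpace ℝ (Fin p)) (α : ℝ) :
    Finset (Fin p) :=
  Finset.univ.filter (fun k => α < w k)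

/-- The set `{w = α}`. -/
noncomputable def valueSet {p : ℕ} (w : EuclideanSpace ℝ (Fin p)) (α : ℝ) : Finset (Fin p) :=
  Finset.univ.filter (fun k => w k = α)

/-- The Lovász extension `f(w) = ∫ F({w ≥ α}) dα`. When `F ∅ = F V = 0` the integrand is a
step function with bounded support. -/
noncomputable def lovasz {p : ℕ} (F : Finset (Fin p) → ℝ) (w : EuclideanSpace ℝ (Fin p)) : ℝ :=
  ∫ α : ℝ, F (levelSet w α)

/-- The base polyhedron `B(F)`. -/
def basePolyhedron {p : ℕ} (F : Finset (Fin p) → ℝ) : Set (EuclideanSpace ℝ (Fin p)) :=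
  {s | (∀ A : Finset (Fin p), ∑ k ∈ A, s k ≤ F A) ∧ ∑ k, s k = F Finset.univ}

/-- The face of `B(F)` exposed by `w`: the maximizers of `s ↦ wᵀ s` over `B(F)`. It is polar to the
face of `{f ≤ 1}` whose relative interior contains the positive multiple of `w` with `f = 1`. -/
def exposedFace {p : ℕ} (F : Finset (Fin p) → ℝ) (w : EuclideanSpace ℝ (Fin p)) :
    Set (EuclideanSpace ℝ (Fin p)) :=
  {s | s ∈ basePolyhedron F ∧ ∀ t ∈ basePolyhedron F, ∑ k, w k * t k ≤ ∑ k, w k * s k}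

/-- The lattice associated to `w`: the sets that are tight on the whole face exposed by `w`. -/
def assocLattice {p : ℕ} (F : Finset (Fin p) → ℝ) (w : EuclideanSpace ℝ (Fin p)) :
    Set (Finset (Fin p)) :=
  {A | ∀ s ∈ exposedFace F w, ∑ k ∈ A, s k = F A}

/-- `i` and `j` are in the same element of the partition of the ground set given by the lattice
associated to `w`: no set of the lattice contains one of them and not the other. -/
def SameConstantSet {p : ℕ} (F : Finset (Fin p) → ℝ) (w : EuclideanSpace ℝ (Fin p))
    (i j : Fin p) : Prop :=
  ∀ A ∈ assocLattice F w, (i ∈ A ↔ j ∈ A)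

/-- `w` minimizes `½ ‖w - z‖² + lam * f(w)` over `ℝᵖ`. -/
def IsProxSolution {p : ℕ} (F : Finset (Fin p) → ℝ) (z : EuclideanSpace ℝ (Fin p)) (lam : ℝ)
    (w : EuclideanSpace ℝ (Fin p)) : Prop :=
  ∀ v : EuclideanSpace ℝ (Fin p),
    1 / 2 * ‖w - z‖ ^ 2 + lam * lovasz F w ≤ 1 / 2 * ‖v - z‖ ^ 2 + lam * lovasz F v

/-! The solution at λ is characterized by w = z - λs with s in the face of B(F) exposed by w. The
core claim is that this face grows with λ (`exposedFace_subset_of_isProxPoint`): a larger face has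
fewer sets tight on all of it, hence a smaller lattice and a coarser partition into constant sets.

To see the growth, let w = z - λs be the solution at λ and let x be s averaged over the constant
sets of w. The hypothesis on F is what keeps x in the face of w
(`constantSetAverage_mem_exposedFace`). Since x is constant on constant sets, so is w - tx, and such
a linear form is constant on the face of w. For small t no strict inequality between coordinates of
w is lost, so the face of w is contained in that of w - tx (`exists_eventually_exposedFace_subset`).
For small t > 0, w - tx = z - (λ + t)s' with s' a convex combination of s and x, so w - tx is the
solution at λ + t. Continuity of the path turns this local growth into global growth.

Inseparable level sets reduce to constant sets: a lattice set cutting one would separate it. -/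

/-! ### Greedy bases -/

/-- `s` is tight on `A`: `s(A) = F(A)`. -/
def IsTight {p : ℕ} (F : Finset (Fin p) → ℝ) (s : EuclideanSpace ℝ (Fin p))
    (A : Finset (Fin p)) : Prop :=
  ∑ k ∈ A, s k = F A

/-- `U` is an upper set for the weak ordering of the ground set induced by `r`. -/
def IsUpperFor {p : ℕ} {L : Type*} [LT L] (r : Fin p → L) (U : Finset (Fin p)) : Prop :=
  ∀ i ∈ U, ∀ j ∉ U, r j < r i

/-- Edmonds' greedy algorithm: each element receives its marginal gain over the elements ranked
above it. The gains telescope along upper sets; on other sets, removing the lowest element and using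
diminishing returns gives the bound. -/
theorem exists_greedy_of_injective {p : ℕ} {F : Finset (Fin p) → ℝ} (hsub : IsSubmodular F)
    (hempty : F ∅ = 0) {L : Type*} [LinearOrder L] (r : Fin p → L)
    (hr : Function.Injective r) :
    ∃ s ∈ basePolyhedron F, ∀ U, IsUpperFor r U → IsTight F s U := by
  classical
  let up : Fin p → Finset (Fin p) := fun k => Finset.univ.filter fun j => r k < r j
  let s : EuclideanSpace ℝ (Fin p) := WithLp.toLp 2 fun k => F (insert k (up k)) - F (up k)
  have hs : ∀ k, s k = F (insert k (up k)) - F (up k) := fun k => rfl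
  have htight : ∀ U, IsUpperFor r U → IsTight F s U := by
    intro U
    induction U using Finset.strongInduction with
    | H U ih =>
      intro hU
      rcases U.eq_empty_or_nonempty with rfl | hne
      · simp [IsTight, hempty]
      obtain ⟨k, hk, hmin⟩ := Finset.exists_min_image U r hne
      have herase : U.erase k = up k := by
        ext j
        simp only [Finset.mem_erase, up, Finset.mem_filter, Finset.mem_univ, true_and]
        constructor
        · rintro ⟨hjk, hj⟩
          exact lt_of_le_of_ne (hmin j hj) fun h => hjk (hr h).symm
        · intro h
          refine ⟨fun e => by simp [e] at h, ?_⟩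
          by_contra hj
          exact lt_asymm h (hU k hk j hj)
      have hup : IsUpperFor r (U.erase k) := by
        intro i hi j hj
        rw [herase] at hi hj
        simp only [up, Finset.mem_filter, Finset.mem_univ, true_and, not_lt] at hi hj
        exact lt_of_le_of_lt hj hi
      have h1 : ∑ j ∈ U.erase k, s j = F (U.erase k) := ih _ (Finset.erase_ssubset hk) hup
      have h2 := Finset.add_sum_erase U (fun j => s j) hk
      have h3 := hs k
      rw [← herase, Finset.insert_erase hk] at h3
      unfold IsTight
      linarith
  refine ⟨s, ⟨?_, htight _ fun i _ j hj => absurd (Finset.mem_univ j) hj⟩, htight⟩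
  intro A
  induction A using Finset.strongInduction with
  | H A ih =>
    rcases A.eq_empty_or_nonempty with rfl | hne
    · simp [hempty]
    obtain ⟨k, hk, hmin⟩ := Finset.exists_min_image A r hne
    have h1 := ih _ (Finset.erase_ssubset hk)
    have h2 := Finset.add_sum_erase A (fun j => s j) hk
    have h3 := hs k
    have hsubset : A.erase k ⊆ up k := by
      intro j hj
      rw [Finset.mem_erase] at hj
      simp only [up, Finset.mem_filter, Finset.mem_univ, true_and]
      exact lt_of_le_of_ne (hmin j hj.2) fun h => hj.1 (hr h).symm
    have hkup : k ∉ up k := by simp [up]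
    have h4 := hsub A (up k)
    have h5 : A ∪ up k = insert k (up k) := by
      ext j
      have := @hsubset j
      simp only [Finset.mem_erase, Finset.mem_union, Finset.mem_insert] at this ⊢
      grind
    have h6 : A ∩ up k = A.erase k := by
      ext j
      have := @hsubset j
      simp only [Finset.mem_erase, Finset.mem_inter] at this ⊢
      grind
    rw [h5, h6] at h4
    linarith

theorem exists_greedy {p : ℕ} {F : Finset (Fin p) → ℝ} (hsub : IsSubmodular F)
    (hempty : F ∅ = 0) {L : Type*} [LinearOrder L] (r : Fin p → L) :
    ∃ s ∈ basePolyhedron F, ∀ U, IsUpperFor r U → IsTight F s U := by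
  obtain ⟨s, hs, ht⟩ := exists_greedy_of_injective hsub hempty
    -- Ties are broken by index; an upper set for `r` remains one for the refined order.
    (fun k => toLex (r k, k)) fun a b h => (Prod.ext_iff.1 (toLex.injective h)).2
  exact ⟨s, hs, fun U hU => ht U fun i hi j hj =>
    Prod.Lex.toLex_lt_toLex.2 (Or.inl (hU i hi j hj))⟩

/-! ### Lovász extension and exposed faces -/

theorem isUpperFor_levelSet {p : ℕ} (w : EuclideanSpace ℝ (Fin p)) (α : ℝ) :
    IsUpperFor w (levelSet w α) := by
  intro i hi j hj
  simp only [levelSet, Finset.mem_filter, Finset.mem_univ, true_and, not_le] at hi hj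
  linarith

theorem isUpperFor_strictLevelSet {p : ℕ} (w : EuclideanSpace ℝ (Fin p)) (α : ℝ) :
    IsUpperFor w (strictLevelSet w α) := by
  intro i hi j hj
  simp only [strictLevelSet, Finset.mem_filter, Finset.mem_univ, true_and, not_lt] at hi hj
  linarith

/-- The interval has positive measure, so an almost-everywhere identity between level-set sums can
be read off at `U`. -/
theorem IsUpperFor.exists_levelSet_eqOn {p : ℕ} {w : EuclideanSpace ℝ (Fin p)}
    {U : Finset (Fin p)} (hU : IsUpperFor w U) (hne : U.Nonempty) :
    ∃ a b : ℝ, a < b ∧ ∀ α ∈ Set.Ioo a b, levelSet w α = U := by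
  obtain ⟨k, hk, hmin⟩ := Finset.exists_min_image U w hne
  have key : ∃ a < w k, ∀ j ∉ U, w j ≤ a := by
    rcases (Finset.univ \ U).eq_empty_or_nonempty with h | h
    · refine ⟨w k - 1, by linarith, fun j hj => ?_⟩
      have : j ∈ Finset.univ \ U := by simp [hj]
      simp [h] at this
    · obtain ⟨l, hl, hmax⟩ := Finset.exists_max_image (Finset.univ \ U) w h
      simp only [Finset.mem_sdiff, Finset.mem_univ, true_and] at hl hmax
      exact ⟨w l, hU k hk l hl, hmax⟩
  obtain ⟨a, ha, hlow⟩ := key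
  refine ⟨a, w k, ha, fun α hα => ?_⟩
  ext j
  simp only [levelSet, Finset.mem_filter, Finset.mem_univ, true_and]
  constructor
  · intro h
    by_contra hj
    linarith [hlow j hj, hα.1]
  · intro h
    linarith [hmin j h, hα.2]

-- Layer-cake formula. As s(V) = 0, the integrand vanishes below min w, and the choice of base point
-- `m` drops out.
open MeasureTheory in
theorem integral_sum_levelSet {p : ℕ} (w s : EuclideanSpace ℝ (Fin p)) (hs : ∑ k, s k = 0) :
    Integrable (fun α : ℝ => ∑ k ∈ levelSet w α, s k) ∧
      ∫ α : ℝ, ∑ k ∈ levelSet w α, s k = ∑ k, w k * s k := by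
  obtain ⟨m, hm⟩ : ∃ m, ∀ k, m ≤ w k := by
    obtain ⟨m, hm⟩ := (Set.finite_range w).bddBelow
    exact ⟨m, fun k => hm ⟨k, rfl⟩⟩
  have hfun : (fun α : ℝ => ∑ k ∈ levelSet w α, s k) =
      fun α => ∑ k, (Set.Ioc m (w k)).indicator (fun _ => s k) α := by
    funext α
    by_cases hα : m < α
    · simp [levelSet, Finset.sum_filter, Set.indicator_apply, hα]
    · have : levelSet w α = Finset.univ := by
        ext k
        simpa [levelSet] using (not_lt.1 hα).trans (hm k)
      simp [this, hs, hα]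
  have hint : ∀ k, Integrable ((Set.Ioc m (w k)).indicator fun _ => s k) := fun k =>
    (integrable_indicator_iff measurableSet_Ioc).2 (integrableOn_const (by simp))
  rw [hfun]
  refine ⟨integrable_finsetSum _ fun k _ => hint k, ?_⟩
  rw [integral_finsetSum _ fun k _ => hint k]
  have : ∀ k, ∫ α, (Set.Ioc m (w k)).indicator (fun _ => s k) α = w k * s k - m * s k := by
    intro k
    rw [integral_indicator measurableSet_Ioc, setIntegral_const]
    simp [Measure.real, ENNReal.toReal_ofReal (sub_nonneg.2 (hm k)), sub_mul]
  simp_rw [this]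
  rw [Finset.sum_sub_distrib, ← Finset.mul_sum, hs]
  simp

theorem lovasz_eq_of_isTight {p : ℕ} {F : Finset (Fin p) → ℝ} (huniv : F Finset.univ = 0)
    {w s : EuclideanSpace ℝ (Fin p)} (hs : s ∈ basePolyhedron F)
    (ht : ∀ U, IsUpperFor w U → IsTight F s U) : lovasz F w = ∑ k, w k * s k := by
  rw [← (integral_sum_levelSet w s (hs.2.trans huniv)).2]
  exact MeasureTheory.integral_congr_ae
    (Filter.Eventually.of_forall fun α => (ht _ (isUpperFor_levelSet w α)).symm)

theorem sum_mul_le_lovasz {p : ℕ} {F : Finset (Fin p) → ℝ} (hsub : IsSubmodular F)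
    (hempty : F ∅ = 0) (huniv : F Finset.univ = 0)
    {w s : EuclideanSpace ℝ (Fin p)} (hs : s ∈ basePolyhedron F) :
    ∑ k, w k * s k ≤ lovasz F w := by
  obtain ⟨g, hg, ht⟩ := exists_greedy hsub hempty w
  have hs' := integral_sum_levelSet w s (hs.2.trans huniv)
  have hg' := integral_sum_levelSet w g (hg.2.trans huniv)
  rw [lovasz_eq_of_isTight huniv hg ht, ← hs'.2, ← hg'.2]
  refine MeasureTheory.integral_mono hs'.1 hg'.1 fun α => ?_
  have := ht _ (isUpperFor_levelSet w α)
  unfold IsTight at this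
  simpa only [this] using hs.1 _

/-- A greedy base dominates `s` on every level set. If `s` is a maximizer the two integrals agree,
hence the integrands agree almost everywhere. -/
theorem mem_exposedFace_iff {p : ℕ} {F : Finset (Fin p) → ℝ} (hsub : IsSubmodular F)
    (hempty : F ∅ = 0) (huniv : F Finset.univ = 0) {w s : EuclideanSpace ℝ (Fin p)} :
    s ∈ exposedFace F w ↔ s ∈ basePolyhedron F ∧ ∀ U, IsUpperFor w U → IsTight F s U := by
  constructor
  · rintro ⟨hs, hmax⟩
    refine ⟨hs, fun U hU => ?_⟩
    rcases U.eq_empty_or_nonempty with rfl | hne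
    · simp [IsTight, hempty]
    obtain ⟨g, hg, ht⟩ := exists_greedy hsub hempty w
    obtain ⟨a, b, hab, hlev⟩ := hU.exists_levelSet_eqOn hne
    have hs' := integral_sum_levelSet w s (hs.2.trans huniv)
    have hg' := integral_sum_levelSet w g (hg.2.trans huniv)
    have hle : (fun α : ℝ => ∑ k ∈ levelSet w α, s k) ≤
        fun α => ∑ k ∈ levelSet w α, g k := fun α => by
      have := ht _ (isUpperFor_levelSet w α)
      unfold IsTight at this
      simpa only [this] using hs.1 _
    have heq : ∫ α : ℝ, ∑ k ∈ levelSet w α, s k = ∫ α : ℝ, ∑ k ∈ levelSet w α, g k := by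
      refine le_antisymm (MeasureTheory.integral_mono hs'.1 hg'.1 hle) ?_
      rw [hs'.2, hg'.2]
      exact hmax g hg
    have hae := (MeasureTheory.integral_eq_iff_of_ae_le hs'.1 hg'.1
      (Filter.Eventually.of_forall hle)).1 heq
    have hpos : MeasureTheory.volume (Set.Ioo a b) ≠ 0 := by simp [hab]
    obtain ⟨α, hα, h⟩ : ∃ α ∈ Set.Ioo a b,
        ∑ k ∈ levelSet w α, s k = ∑ k ∈ levelSet w α, g k := by
      by_contra hcon
      push Not at hcon
      exact hpos (MeasureTheory.measure_mono_null hcon hae)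
    rw [hlev α hα] at h
    exact h.trans (ht U hU)
  · rintro ⟨hs, ht⟩
    refine ⟨hs, fun t ht' => ?_⟩
    rw [← lovasz_eq_of_isTight huniv hs ht]
    exact sum_mul_le_lovasz hsub hempty huniv ht'

theorem exposedFace_nonempty {p : ℕ} {F : Finset (Fin p) → ℝ} (hsub : IsSubmodular F)
    (hempty : F ∅ = 0) (huniv : F Finset.univ = 0) (w : EuclideanSpace ℝ (Fin p)) :
    (exposedFace F w).Nonempty := by
  obtain ⟨s, hs, ht⟩ := exists_greedy hsub hempty w
  exact ⟨s, (mem_exposedFace_iff hsub hempty huniv).2 ⟨hs, ht⟩⟩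

theorem lovasz_eq_of_mem_exposedFace {p : ℕ} {F : Finset (Fin p) → ℝ} (hsub : IsSubmodular F)
    (hempty : F ∅ = 0) (huniv : F Finset.univ = 0) {w s : EuclideanSpace ℝ (Fin p)}
    (hs : s ∈ exposedFace F w) : lovasz F w = ∑ k, w k * s k :=
  have h := (mem_exposedFace_iff hsub hempty huniv).1 hs
  lovasz_eq_of_isTight huniv h.1 h.2

/-! ### Convexity and the proximal problem -/

theorem inner_eq_sum_mul {p : ℕ} (w s : EuclideanSpace ℝ (Fin p)) :
    inner ℝ w s = ∑ k, w k * s k := by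
  simp [PiLp.inner_apply, mul_comm]

theorem continuous_sum_apply {p : ℕ} (A : Finset (Fin p)) :
    Continuous fun s : EuclideanSpace ℝ (Fin p) => ∑ k ∈ A, s k := by
  fun_prop

theorem isClosed_basePolyhedron {p : ℕ} (F : Finset (Fin p) → ℝ) :
    IsClosed (basePolyhedron F) := by
  simp only [basePolyhedron, Set.ofPred_and, Set.ofPred_forall]
  exact (isClosed_iInter fun A => isClosed_le (continuous_sum_apply A) continuous_const).inter
    (isClosed_eq (continuous_sum_apply _) continuous_const)

theorem convex_basePolyhedron {p : ℕ} (F : Finset (Fin p) → ℝ) :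
    Convex ℝ (basePolyhedron F) := by
  intro s hs t ht a b ha hb hab
  have key : ∀ A : Finset (Fin p),
      ∑ k ∈ A, (a • s + b • t) k = a * ∑ k ∈ A, s k + b * ∑ k ∈ A, t k := fun A => by
    simp [Finset.sum_add_distrib, Finset.mul_sum]
  refine ⟨fun A => ?_, ?_⟩
  · rw [key]
    calc _ ≤ a * F A + b * F A := by gcongr <;> [exact hs.1 A; exact ht.1 A]
      _ = F A := by rw [← add_mul, hab, one_mul]
  · rw [key, hs.2, ht.2, ← add_mul, hab, one_mul]

theorem convex_exposedFace {p : ℕ} (F : Finset (Fin p) → ℝ) (w : EuclideanSpace ℝ (Fin p)) :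
    Convex ℝ (exposedFace F w) := by
  intro s hs t ht a b ha hb hab
  refine ⟨convex_basePolyhedron F hs.1 ht.1 ha hb hab, fun x hx => ?_⟩
  have h1 := hs.2 x hx
  have h2 := ht.2 x hx
  simp only [← inner_eq_sum_mul] at h1 h2 ⊢
  rw [inner_add_right, inner_smul_right, inner_smul_right]
  calc inner ℝ w x = a * inner ℝ w x + b * inner ℝ w x := by rw [← add_mul, hab, one_mul]
    _ ≤ _ := by gcongr

/-- The optimality condition `z - w ∈ lam • ∂f(w)` of the proximal problem. -/
def IsProxPoint {p : ℕ} (F : Finset (Fin p) → ℝ) (z : EuclideanSpace ℝ (Fin p)) (lam : ℝ)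
    (w : EuclideanSpace ℝ (Fin p)) : Prop :=
  ∃ s ∈ exposedFace F w, w = z - lam • s

/-- Strong convexity: the extra term ½‖v - w‖² yields both minimality and uniqueness. -/
theorem IsProxPoint.add_norm_sq_le {p : ℕ} {F : Finset (Fin p) → ℝ} (hsub : IsSubmodular F)
    (hempty : F ∅ = 0) (huniv : F Finset.univ = 0) {z w : EuclideanSpace ℝ (Fin p)} {lam : ℝ}
    (hlam : 0 ≤ lam) (h : IsProxPoint F z lam w) (v : EuclideanSpace ℝ (Fin p)) :
    1 / 2 * ‖w - z‖ ^ 2 + lam * lovasz F w + 1 / 2 * ‖v - w‖ ^ 2 ≤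
      1 / 2 * ‖v - z‖ ^ 2 + lam * lovasz F v := by
  obtain ⟨s, hs, hw⟩ := h
  have h1 := sum_mul_le_lovasz hsub hempty huniv (w := v) hs.1
  have h2 := lovasz_eq_of_mem_exposedFace hsub hempty huniv hs
  rw [← inner_eq_sum_mul] at h1 h2
  have h3 : v - z = (v - w) + (w - z) := by abel
  have h4 : w - z = -(lam • s) := by rw [hw]; abel
  have h5 : inner ℝ (v - w) (w - z) = -(lam * (inner ℝ v s - inner ℝ w s)) := by
    rw [h4, inner_neg_right, inner_smul_right, inner_sub_left]
  rw [h3, norm_add_sq_real, h5, h2]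
  nlinarith [mul_le_mul_of_nonneg_left h1 hlam]

/-- By duality `s` is the projection of z/λ onto B(F): the variational inequality of the projection
says that `s` maximizes the linear form z - λs. -/
theorem exists_isProxPoint {p : ℕ} {F : Finset (Fin p) → ℝ} (hsub : IsSubmodular F)
    (hempty : F ∅ = 0) (huniv : F Finset.univ = 0) (z : EuclideanSpace ℝ (Fin p)) {lam : ℝ}
    (hlam : 0 ≤ lam) : ∃ w, IsProxPoint F z lam w := by
  rcases hlam.eq_or_lt with rfl | hpos
  · obtain ⟨s, hs⟩ := exposedFace_nonempty hsub hempty huniv z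
    exact ⟨z, s, hs, by simp⟩
  obtain ⟨s₀, hs₀⟩ := exposedFace_nonempty hsub hempty huniv z
  obtain ⟨s, hs, hproj⟩ := exists_norm_eq_iInf_of_complete_convex ⟨s₀, hs₀.1⟩
    (isClosed_basePolyhedron F).isComplete (convex_basePolyhedron F) (lam⁻¹ • z)
  rw [norm_eq_iInf_iff_real_inner_le_zero (convex_basePolyhedron F) hs] at hproj
  refine ⟨z - lam • s, s, ⟨hs, fun t ht => ?_⟩, rfl⟩
  have h1 : z - lam • s = lam • (lam⁻¹ • z - s) := by
    rw [smul_sub, smul_inv_smul₀ hpos.ne']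
  have h2 := mul_nonpos_of_nonneg_of_nonpos hlam (hproj t ht)
  rw [← real_inner_smul_left, ← h1, inner_sub_right] at h2
  rw [← inner_eq_sum_mul, ← inner_eq_sum_mul]
  linarith

theorem IsProxPoint.isProxSolution {p : ℕ} {F : Finset (Fin p) → ℝ} (hsub : IsSubmodular F)
    (hempty : F ∅ = 0) (huniv : F Finset.univ = 0) {z w : EuclideanSpace ℝ (Fin p)} {lam : ℝ}
    (hlam : 0 ≤ lam) (h : IsProxPoint F z lam w) : IsProxSolution F z lam w := fun v => by
  have := h.add_norm_sq_le hsub hempty huniv hlam v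
  nlinarith [sq_nonneg ‖v - w‖]

theorem IsProxPoint.eq_of_isProxSolution {p : ℕ} {F : Finset (Fin p) → ℝ}
    (hsub : IsSubmodular F) (hempty : F ∅ = 0) (huniv : F Finset.univ = 0)
    {z w v : EuclideanSpace ℝ (Fin p)} {lam : ℝ} (hlam : 0 ≤ lam) (h : IsProxPoint F z lam w)
    (hv : IsProxSolution F z lam v) : v = w := by
  have h1 := h.add_norm_sq_le hsub hempty huniv hlam v
  have h2 := hv w
  have h3 : ‖v - w‖ ^ 2 ≤ 0 := by linarith
  exact sub_eq_zero.1 (norm_eq_zero.1 (pow_eq_zero_iff two_ne_zero |>.1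
    (le_antisymm h3 (sq_nonneg _))))

theorem isProxSolution_iff_isProxPoint {p : ℕ} {F : Finset (Fin p) → ℝ}
    (hsub : IsSubmodular F) (hempty : F ∅ = 0) (huniv : F Finset.univ = 0)
    {z w : EuclideanSpace ℝ (Fin p)} {lam : ℝ} (hlam : 0 ≤ lam) :
    IsProxSolution F z lam w ↔ IsProxPoint F z lam w := by
  refine ⟨fun h => ?_, fun h => h.isProxSolution hsub hempty huniv hlam⟩
  obtain ⟨v, hv⟩ := exists_isProxPoint hsub hempty huniv z hlam
  exact hv.eq_of_isProxSolution hsub hempty huniv hlam h ▸ hv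

theorem existsUnique_isProxSolution {p : ℕ} {F : Finset (Fin p) → ℝ} (hsub : IsSubmodular F)
    (hempty : F ∅ = 0) (huniv : F Finset.univ = 0) (z : EuclideanSpace ℝ (Fin p)) {lam : ℝ}
    (hlam : 0 ≤ lam) : ∃! w, IsProxSolution F z lam w := by
  obtain ⟨w, hw⟩ := exists_isProxPoint hsub hempty huniv z hlam
  exact ⟨w, hw.isProxSolution hsub hempty huniv hlam,
    fun v hv => hw.eq_of_isProxSolution hsub hempty huniv hlam hv⟩

/-! ### Continuity of the path -/

/-- Maximality on both faces gives ⟨w - w', s - s'⟩ ≥ 0. The bound involves only `s`, so continuity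
at `lam` needs no bound on B(F). -/
theorem norm_sub_le_of_mem_exposedFace {p : ℕ} {F : Finset (Fin p) → ℝ}
    {z w w' s s' : EuclideanSpace ℝ (Fin p)} {lam lam' : ℝ} (hlam' : 0 ≤ lam')
    (hs : s ∈ exposedFace F w) (hw : w = z - lam • s)
    (hs' : s' ∈ exposedFace F w') (hw' : w' = z - lam' • s') :
    ‖w - w'‖ ≤ |lam' - lam| * ‖s‖ := by
  have h1 := hs.2 s' hs'.1
  have h2 := hs'.2 s hs.1
  simp only [← inner_eq_sum_mul] at h1 h2
  have hmono : 0 ≤ inner ℝ (w - w') (s - s') := by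
    simp only [inner_sub_left, inner_sub_right]
    linarith
  have hdiff : w - w' = (lam' - lam) • s - lam' • (s - s') := by
    rw [hw, hw']; module
  have h3 : ‖w - w'‖ * ‖w - w'‖ ≤ |lam' - lam| * ‖s‖ * ‖w - w'‖ := by
    calc ‖w - w'‖ * ‖w - w'‖ = inner ℝ (w - w') (w - w') := (real_inner_self_eq_norm_mul_norm _).symm
      _ = inner ℝ (w - w') ((lam' - lam) • s) - lam' * inner ℝ (w - w') (s - s') := by
        conv_lhs => rw [show inner ℝ (w - w') (w - w') =
          inner ℝ (w - w') ((lam' - lam) • s - lam' • (s - s')) by rw [← hdiff]]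
        rw [inner_sub_right, inner_smul_right _ (s - s')]
      _ ≤ inner ℝ (w - w') ((lam' - lam) • s) := by
        linarith [mul_nonneg hlam' hmono]
      _ ≤ ‖w - w'‖ * ‖(lam' - lam) • s‖ := real_inner_le_norm _ _
      _ = _ := by rw [norm_smul, Real.norm_eq_abs]; ring
  rcases (norm_nonneg (w - w')).eq_or_lt with h | h
  · rw [← h]; positivity
  · exact le_of_mul_le_mul_right h3 h

theorem mem_exposedFace_of_tendsto {p : ℕ} {F : Finset (Fin p) → ℝ}
    {s w : EuclideanSpace ℝ (Fin p)} {ι : Type*} {l : Filter ι} [l.NeBot]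
    {x : ι → EuclideanSpace ℝ (Fin p)} (hx : Filter.Tendsto x l (nhds w))
    (hs : ∀ᶠ n in l, s ∈ exposedFace F (x n)) : s ∈ exposedFace F w := by
  obtain ⟨n, hn⟩ := hs.exists
  refine ⟨hn.1, fun t ht => ?_⟩
  simp only [← inner_eq_sum_mul]
  refine le_of_tendsto_of_tendsto (hx.inner tendsto_const_nhds) (hx.inner tendsto_const_nhds)
    (hs.mono fun m hm => ?_)
  simpa only [inner_eq_sum_mul] using hm.2 t ht

/-! ### The lattice and its constant sets -/

theorem mem_assocLattice_of_isUpperFor {p : ℕ} {F : Finset (Fin p) → ℝ}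
    (hsub : IsSubmodular F) (hempty : F ∅ = 0) (huniv : F Finset.univ = 0)
    {w : EuclideanSpace ℝ (Fin p)} {U : Finset (Fin p)} (hU : IsUpperFor w U) :
    U ∈ assocLattice F w := fun _ hs =>
  ((mem_exposedFace_iff hsub hempty huniv).1 hs).2 U hU

theorem union_inter_mem_assocLattice {p : ℕ} {F : Finset (Fin p) → ℝ} (hsub : IsSubmodular F)
    {w : EuclideanSpace ℝ (Fin p)} {A B : Finset (Fin p)} (hA : A ∈ assocLattice F w)
    (hB : B ∈ assocLattice F w) : A ∪ B ∈ assocLattice F w ∧ A ∩ B ∈ assocLattice F w := by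
  refine forall₂_and.1 ?_
  intro s hs
  have h1 := hA s hs
  have h2 := hB s hs
  have h3 := hs.1.1 (A ∪ B)
  have h4 := hs.1.1 (A ∩ B)
  have h5 := Finset.sum_union_inter (s₁ := A) (s₂ := B) (f := fun k => s k)
  have h6 := hsub A B
  constructor <;> linarith

theorem SameConstantSet.apply_eq {p : ℕ} {F : Finset (Fin p) → ℝ}
    (hsub : IsSubmodular F) (hempty : F ∅ = 0) (huniv : F Finset.univ = 0)
    {w : EuclideanSpace ℝ (Fin p)} {i j : Fin p} (h : SameConstantSet F w i j) : w i = w j := by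
  have key : ∀ k, levelSet w (w k) ∈ assocLattice F w := fun k =>
    mem_assocLattice_of_isUpperFor hsub hempty huniv (isUpperFor_levelSet w _)
  have h1 := (h _ (key i)).1 (by simp [levelSet])
  have h2 := (h _ (key j)).2 (by simp [levelSet])
  simp only [levelSet, Finset.mem_filter, Finset.mem_univ, true_and] at h1 h2
  exact le_antisymm h1 h2

/-- Descent along a maximal chain of the lattice, each of whose steps `M \ N` is one constant set:
for `A` in the lattice, N ∪ (A ∩ M) lies between `N` and `M`, hence equals one of them. -/
theorem assocLattice_induction {p : ℕ} {F : Finset (Fin p) → ℝ} (hsub : IsSubmodular F)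
    (hempty : F ∅ = 0) (w : EuclideanSpace ℝ (Fin p)) {motive : Finset (Fin p) → Prop}
    (empty : motive ∅)
    (step : ∀ M N, M ∈ assocLattice F w → N ∈ assocLattice F w → N ⊂ M →
      (∀ i ∈ M \ N, ∀ j, SameConstantSet F w i j ↔ j ∈ M \ N) → motive N → motive M)
    {M : Finset (Fin p)} (hM : M ∈ assocLattice F w) : motive M := by
  classical
  induction M using Finset.strongInduction with
  | H M ih =>
    rcases M.eq_empty_or_nonempty with rfl | hne
    · exact empty
    have hsne : (Finset.univ.filter fun N => N ∈ assocLattice F w ∧ N ⊂ M).Nonempty :=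
      ⟨∅, by simpa [assocLattice, hempty, Finset.empty_ssubset] using hne⟩
    obtain ⟨N, hN, hmax⟩ := Finset.exists_max_image _ Finset.card hsne
    simp only [Finset.mem_filter, Finset.mem_univ, true_and] at hN hmax
    refine step M N hM hN.1 hN.2 (fun i hi j => ?_) (ih N hN.2 hN.1)
    rw [Finset.mem_sdiff] at hi
    constructor
    · intro h
      rw [Finset.mem_sdiff]
      exact ⟨(h M hM).1 hi.1, fun hj => hi.2 ((h N hN.1).2 hj)⟩
    · intro hj A hA
      rw [Finset.mem_sdiff] at hj
      have hmem := (union_inter_mem_assocLattice hsub hN.1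
        (union_inter_mem_assocLattice hsub hA hM).2).1
      have hle : N ∪ A ∩ M ⊆ M := Finset.union_subset hN.2.1 Finset.inter_subset_right
      rcases hle.eq_or_ssubset with h | h
      · have h1 : i ∈ N ∪ A ∩ M := h.symm.subset hi.1
        have h2 : j ∈ N ∪ A ∩ M := h.symm.subset hj.1
        simp only [Finset.mem_union, Finset.mem_inter] at h1 h2
        tauto
      · have h3 := Finset.eq_of_subset_of_card_le Finset.subset_union_left (hmax _ ⟨hmem, h⟩)
        have h1 : i ∉ N ∪ A ∩ M := h3 ▸ hi.2
        have h2 : j ∉ N ∪ A ∩ M := h3 ▸ hj.2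
        simp only [Finset.mem_union, Finset.mem_inter] at h1 h2
        tauto

/-- If F(M) - F(N) splits over `B` and `C`, the bounds on s(B) and s(C) are both attained on the
face, so N ∪ B is a lattice set cutting a constant set. -/
theorem not_isSeparableSet_sdiff {p : ℕ} {F : Finset (Fin p) → ℝ}
    {w : EuclideanSpace ℝ (Fin p)} {M N : Finset (Fin p)}
    (hM : M ∈ assocLattice F w) (hN : N ∈ assocLattice F w) (hNM : N ⊆ M)
    (hclass : ∀ i ∈ M \ N, ∀ j ∈ M \ N, SameConstantSet F w i j) :
    ¬ IsSeparableSet (contraction F N) (M \ N) := by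
  rintro ⟨B, C, ⟨b, hb⟩, ⟨c, hc⟩, hBC, hunion, hsep⟩
  have hbM : b ∈ M \ N := hunion ▸ Finset.mem_union_left _ hb
  have hcM : c ∈ M \ N := hunion ▸ Finset.mem_union_right _ hc
  have hdB : Disjoint N B :=
    Finset.disjoint_of_subset_right (hunion ▸ Finset.subset_union_left) Finset.disjoint_sdiff
  have hdC : Disjoint N C :=
    Finset.disjoint_of_subset_right (hunion ▸ Finset.subset_union_right) Finset.disjoint_sdiff
  have hNB : N ∪ B ∈ assocLattice F w := by
    intro s hs
    have h1 := hM s hs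
    have h2 := hN s hs
    have h3 := hs.1.1 (N ∪ B)
    have h4 := hs.1.1 (N ∪ C)
    have h5 := Finset.sum_sdiff hNM (f := fun k => s k)
    rw [← hunion, Finset.sum_union hBC] at h5
    simp only [contraction, Finset.union_sdiff_of_subset hNM] at hsep
    rw [Finset.sum_union hdB] at h3 ⊢
    rw [Finset.sum_union hdC] at h4
    linarith
  have h := (hclass b hbM c hcM _ hNB).1 (Finset.mem_union_right _ hb)
  rcases Finset.mem_union.1 h with h | h
  · exact (Finset.mem_sdiff.1 hcM).2 h
  · exact Finset.disjoint_left.1 hBC h hc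

/-- Every point of the face has the same mass F(M) - F(N) on each block of the chain. -/
theorem sum_mul_eq_of_mem_exposedFace {p : ℕ} {F : Finset (Fin p) → ℝ} (hsub : IsSubmodular F)
    (hempty : F ∅ = 0) {w x s t : EuclideanSpace ℝ (Fin p)}
    (hx : ∀ i j, SameConstantSet F w i j → x i = x j)
    (hs : s ∈ exposedFace F w) (ht : t ∈ exposedFace F w) :
    ∑ k, x k * s k = ∑ k, x k * t k := by
  refine assocLattice_induction hsub hempty w
    (motive := fun M => ∑ k ∈ M, x k * s k = ∑ k ∈ M, x k * t k) (by simp) ?_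
    (fun y hy => hy.1.2)
  intro M N hM hN hNM hclass ih
  rw [← Finset.sum_sdiff hNM.1, ← Finset.sum_sdiff hNM.1, ih]
  congr 1
  obtain ⟨i, hi⟩ := Finset.sdiff_nonempty.2 hNM.2
  have hconst : ∀ y : EuclideanSpace ℝ (Fin p),
      ∑ k ∈ M \ N, x k * y k = x i * ∑ k ∈ M \ N, y k := fun y => by
    rw [Finset.mul_sum]
    exact Finset.sum_congr rfl fun k hk => by rw [hx i k ((hclass i hi k).2 hk)]
  have hdiff : ∀ y ∈ exposedFace F w, ∑ k ∈ M \ N, y k = F M - F N := fun y hy => by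
    have := Finset.sum_sdiff hNM.1 (f := fun k => y k)
    linarith [hM y hy, hN y hy]
  rw [hconst, hconst, hdiff s hs, hdiff t ht]

/-! ### Averaging over constant sets -/

open Classical in
/-- The vector obtained from `s` by averaging over each constant set of `w`. -/
noncomputable def constantSetAverage {p : ℕ} (F : Finset (Fin p) → ℝ)
    (w s : EuclideanSpace ℝ (Fin p)) : EuclideanSpace ℝ (Fin p) :=
  WithLp.toLp 2 fun k =>
    (∑ j with SameConstantSet F w k j, s j) /
      ((Finset.univ.filter fun j => SameConstantSet F w k j).card : ℝ)

theorem SameConstantSet.constantSetAverage_eq {p : ℕ} {F : Finset (Fin p) → ℝ}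
    {w : EuclideanSpace ℝ (Fin p)} (s : EuclideanSpace ℝ (Fin p)) {i j : Fin p}
    (h : SameConstantSet F w i j) : constantSetAverage F w s i = constantSetAverage F w s j := by
  classical
  have hiff : ∀ k, SameConstantSet F w i k ↔ SameConstantSet F w j k := fun k =>
    ⟨fun hk A hA => (h A hA).symm.trans (hk A hA), fun hk A hA => (h A hA).trans (hk A hA)⟩
  simp only [constantSetAverage, Finset.filter_congr fun k _ => hiff k]

/-- Climbing the chain, x(A \ N) ≤ F(A ∪ N) - F(N) is the hypothesis for the inseparable block `M \
N`, and x(A ∩ N) ≤ F(A ∩ N) is the induction. Submodularity adds them up to x(A) ≤ F(A). -/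
theorem constantSetAverage_mem_exposedFace {p : ℕ} {F : Finset (Fin p) → ℝ}
    (hsub : IsSubmodular F) (hempty : F ∅ = 0) (huniv : F Finset.univ = 0)
    (hagglo : ∀ A B : Finset (Fin p), Disjoint A B → ¬ IsSeparableSet (contraction F B) A →
      ∀ C ⊆ A, (C.card : ℝ) / (A.card : ℝ) * (F (B ∪ A) - F B) ≤ F (B ∪ C) - F B)
    {w s : EuclideanSpace ℝ (Fin p)} (hs : s ∈ exposedFace F w) :
    constantSetAverage F w s ∈ exposedFace F w := by
  classical
  set x := constantSetAverage F w s with hxdef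
  have key : ∀ M ∈ assocLattice F w, ∑ k ∈ M, x k = ∑ k ∈ M, s k ∧
      ∀ A ⊆ M, ∑ k ∈ A, x k ≤ F A := by
    intro M hM
    refine assocLattice_induction hsub hempty w (motive := fun M =>
      ∑ k ∈ M, x k = ∑ k ∈ M, s k ∧ ∀ A ⊆ M, ∑ k ∈ A, x k ≤ F A) ?_ ?_ hM
    · refine ⟨by simp, fun A hA => ?_⟩
      rw [Finset.subset_empty.1 hA]
      simp [hempty]
    intro M N hM hN hNM hclass ih
    have hval : ∀ i ∈ M \ N, x i = (F M - F N) / ((M \ N).card : ℝ) := by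
      intro i hi
      have hfilter : (Finset.univ.filter fun j => SameConstantSet F w i j) = M \ N := by
        ext j
        rw [Finset.mem_filter, hclass i hi j]
        simp
      have hsum := Finset.sum_sdiff hNM.1 (f := fun k => s k)
      have hM' := hM s hs
      have hN' := hN s hs
      have hdiff : ∑ k ∈ M \ N, s k = F M - F N := by linarith
      rw [← hdiff, ← hfilter, hxdef]
      simp only [constantSetAverage]
    have hsumC : ∀ C ⊆ M \ N,
        ∑ k ∈ C, x k = (C.card : ℝ) / ((M \ N).card : ℝ) * (F M - F N) := by
      intro C hC
      rw [Finset.sum_congr rfl fun k hk => hval k (hC hk), Finset.sum_const, nsmul_eq_mul]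
      ring
    have hcard : ((M \ N).card : ℝ) ≠ 0 :=
      Nat.cast_ne_zero.2 (Finset.card_ne_zero.2 (Finset.sdiff_nonempty.2 hNM.2))
    refine ⟨?_, fun A hA => ?_⟩
    · rw [← Finset.sum_sdiff hNM.1, hsumC _ subset_rfl, div_self hcard, one_mul, ih.1,
        hM s hs, hN s hs]
      ring
    · have hinsep := not_isSeparableSet_sdiff hM hN hNM.1
        fun i hi j hj => (hclass i hi j).2 hj
      have hC : A \ N ⊆ M \ N := Finset.sdiff_subset_sdiff hA subset_rfl
      have h1 := hagglo _ _ Finset.sdiff_disjoint hinsep _ hC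
      rw [Finset.union_sdiff_of_subset hNM.1, ← hsumC _ hC, Finset.union_sdiff_self_eq_union] at h1
      have h2 := ih.2 (A ∩ N) Finset.inter_subset_right
      have h3 := hsub A N
      have h4 := Finset.sum_inter_add_sum_sdiff A N fun k => x k
      rw [Finset.union_comm A N] at h3
      linarith
  have huniv_mem : Finset.univ ∈ assocLattice F w := fun y hy => hy.1.2
  rw [mem_exposedFace_iff hsub hempty huniv]
  refine ⟨⟨fun A => (key _ huniv_mem).2 A (Finset.subset_univ A),
    (key _ huniv_mem).1.trans hs.1.2⟩, fun U hU => ?_⟩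
  have hUmem := mem_assocLattice_of_isUpperFor hsub hempty huniv hU
  exact (key U hUmem).1.trans (hUmem s hs)

/-! ### Growth of the face along the path -/

/-- Refining the order of the coordinates adds upper sets, hence tightness constraints. -/
theorem exposedFace_subset_of_lt {p : ℕ} {F : Finset (Fin p) → ℝ} (hsub : IsSubmodular F)
    (hempty : F ∅ = 0) (huniv : F Finset.univ = 0) {w w' : EuclideanSpace ℝ (Fin p)}
    (h : ∀ i j, w j < w i → w' j < w' i) : exposedFace F w' ⊆ exposedFace F w := by
  intro s hs
  rw [mem_exposedFace_iff hsub hempty huniv] at hs ⊢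
  exact ⟨hs.1, fun U hU => hs.2 U fun i hi j hj => h i j (hU i hi j hj)⟩

theorem exists_eventually_exposedFace_subset {p : ℕ} {F : Finset (Fin p) → ℝ}
    (hsub : IsSubmodular F) (hempty : F ∅ = 0) (huniv : F Finset.univ = 0)
    (hagglo : ∀ A B : Finset (Fin p), Disjoint A B → ¬ IsSeparableSet (contraction F B) A →
      ∀ C ⊆ A, (C.card : ℝ) / (A.card : ℝ) * (F (B ∪ A) - F B) ≤ F (B ∪ C) - F B)
    (w : EuclideanSpace ℝ (Fin p)) :
    ∃ x ∈ exposedFace F w, ∀ᶠ t in nhds (0 : ℝ),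
      exposedFace F w ⊆ exposedFace F (w - t • x) := by
  obtain ⟨s, hs⟩ := exposedFace_nonempty hsub hempty huniv w
  refine ⟨constantSetAverage F w s,
    constantSetAverage_mem_exposedFace hsub hempty huniv hagglo hs, ?_⟩
  set x := constantSetAverage F w s with hxdef
  have hev : ∀ᶠ t in nhds (0 : ℝ), ∀ i j, w j < w i → (w - t • x) j < (w - t • x) i := by
    rw [Filter.eventually_all]
    intro i
    rw [Filter.eventually_all]
    intro j
    by_cases hij : w j < w i
    · have hc : ∀ k, Continuous fun t : ℝ => (w - t • x) k := fun k => by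
        simp only [PiLp.sub_apply, PiLp.smul_apply, smul_eq_mul]
        fun_prop
      exact ((hc j).continuousAt.eventually_lt (hc i).continuousAt (by simpa using hij)).mono
        fun t ht _ => ht
    · exact Filter.Eventually.of_forall fun t h => absurd h hij
  filter_upwards [hev] with t ht y hy
  -- The maximizer `g` for the perturbed vector stays in the face of `w`, where the perturbed form
  -- is constant; hence all of that face is maximal.
  obtain ⟨g, hg⟩ := exposedFace_nonempty hsub hempty huniv (w - t • x)
  have hgw := exposedFace_subset_of_lt hsub hempty huniv ht hg
  have heq := sum_mul_eq_of_mem_exposedFace hsub hempty (x := w - t • x) (fun i j h => by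
    simp [h.apply_eq hsub hempty huniv, hxdef, h.constantSetAverage_eq s]) hy hgw
  exact ⟨hy.1, fun v hv => (hg.2 v hv).trans heq.ge⟩

theorem exposedFace_subset_of_isProxPoint {p : ℕ} {F : Finset (Fin p) → ℝ}
    (hsub : IsSubmodular F) (hempty : F ∅ = 0) (huniv : F Finset.univ = 0)
    (hagglo : ∀ A B : Finset (Fin p), Disjoint A B → ¬ IsSeparableSet (contraction F B) A →
      ∀ C ⊆ A, (C.card : ℝ) / (A.card : ℝ) * (F (B ∪ A) - F B) ≤ F (B ∪ C) - F B)
    {z u v : EuclideanSpace ℝ (Fin p)} {mu lam : ℝ} (hmu : 0 ≤ mu) (hmulam : mu ≤ lam)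
    (hu : IsProxPoint F z mu u) (hv : IsProxPoint F z lam v) :
    exposedFace F u ⊆ exposedFace F v := by
  have huniq : ∀ {l : ℝ} {a b : EuclideanSpace ℝ (Fin p)}, 0 ≤ l → IsProxPoint F z l a →
      IsProxPoint F z l b → a = b := fun hl ha hb =>
    hb.eq_of_isProxSolution hsub hempty huniv hl (ha.isProxSolution hsub hempty huniv hl)
  have hex : ∀ l : ℝ, ∃ w s : EuclideanSpace ℝ (Fin p), 0 ≤ l →
      s ∈ exposedFace F w ∧ w = z - l • s := fun l => by
    by_cases hl : 0 ≤ l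
    · obtain ⟨w, s, h⟩ := exists_isProxPoint hsub hempty huniv z hl
      exact ⟨w, s, fun _ => h⟩
    -- Negative parameters get a default value, so that `choose` gives functions on all of ℝ.
    · exact ⟨0, 0, fun h => absurd h hl⟩
  choose w s hws using hex
  have hcont : ContinuousOn w (Set.Icc mu lam) := by
    intro l hl
    rw [ContinuousWithinAt, tendsto_iff_norm_sub_tendsto_zero]
    have hlim : Filter.Tendsto (fun l' : ℝ => |l' - l| * ‖s l‖) (nhdsWithin l (Set.Icc mu lam))
        (nhds 0) := by
      have : Continuous fun l' : ℝ => |l' - l| * ‖s l‖ := by fun_prop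
      simpa using (this.tendsto l).mono_left nhdsWithin_le_nhds
    refine squeeze_zero' (Filter.Eventually.of_forall fun _ => norm_nonneg _) ?_ hlim
    filter_upwards [self_mem_nhdsWithin] with l' hl'
    obtain ⟨h1, h2⟩ := hws l (hmu.trans hl.1)
    obtain ⟨h3, h4⟩ := hws l' (hmu.trans hl'.1)
    rw [norm_sub_rev]
    exact norm_sub_le_of_mem_exposedFace (hmu.trans hl'.1) h1 h2 h3 h4
  have hmem : Set.Icc mu lam ⊆ {l | exposedFace F u ⊆ exposedFace F (w l)} := by
    -- Continuous induction on [mu, lam]: the good parameters form a closed set containing `mu` and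
    -- open to the right.
    refine IsClosed.Icc_subset_of_forall_mem_nhdsWithin ?_ ?_ ?_
    · rw [← closure_subset_iff_isClosed]
      intro l hl
      have hlI : l ∈ Set.Icc mu lam :=
        closure_minimal Set.inter_subset_right isClosed_Icc hl
      refine ⟨fun y hy => ?_, hlI⟩
      have := mem_closure_iff_nhdsWithin_neBot.1 hl
      refine mem_exposedFace_of_tendsto (l := nhdsWithin l
        ({l | exposedFace F u ⊆ exposedFace F (w l)} ∩ Set.Icc mu lam))
        ((hcont l hlI).mono_left (nhdsWithin_mono _ Set.inter_subset_right)) ?_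
      filter_upwards [self_mem_nhdsWithin] with l' hl'
      exact hl'.1 hy
    · show exposedFace F u ⊆ exposedFace F (w mu)
      rw [huniq hmu hu ⟨_, hws mu hmu⟩]
    · rintro l ⟨hl, hlI⟩
      obtain ⟨hs, hw⟩ := hws l (hmu.trans hlI.1)
      obtain ⟨x, hx, hev⟩ := exists_eventually_exposedFace_subset hsub hempty huniv hagglo (w l)
      have hlim : Filter.Tendsto (fun l' : ℝ => l' - l) (nhds l) (nhds 0) := by
        have : Continuous fun l' : ℝ => l' - l := by fun_prop
        simpa using this.tendsto l
      have hev' := (hlim.eventually hev).filter_mono (nhdsWithin_le_nhds (s := Set.Ioi l))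
      filter_upwards [hev', self_mem_nhdsWithin] with l' hl' hgt
      have hl0 : 0 ≤ l := hmu.trans hlI.1
      have hpos : 0 < l' := hl0.trans_lt hgt
      have hprox : IsProxPoint F z l' (w l - (l' - l) • x) := by
        refine ⟨(l / l') • s l + ((l' - l) / l') • x,
          convex_exposedFace F _ (hl' hs) (hl' hx) (by positivity)
            (div_nonneg (sub_nonneg.2 hgt.le) hpos.le) (by field_simp; ring), ?_⟩
        rw [smul_add, smul_smul, smul_smul, mul_div_cancel₀ _ hpos.ne',
          mul_div_cancel₀ _ hpos.ne']
        conv_lhs => rw [hw]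
        abel
      show exposedFace F u ⊆ exposedFace F (w l')
      rw [← huniq hpos.le hprox ⟨_, hws l' hpos.le⟩]
      exact hl.trans hl'
  rw [huniq (hmu.trans hmulam) hv ⟨_, hws lam (hmu.trans hmulam)⟩]
  exact hmem ⟨hmulam, le_rfl⟩

/-! ### Inseparable level sets -/

theorem sameConstantSet_of_not_isSeparableSet {p : ℕ} {F : Finset (Fin p) → ℝ}
    (hsub : IsSubmodular F) (hempty : F ∅ = 0) (huniv : F Finset.univ = 0)
    {w : EuclideanSpace ℝ (Fin p)} {α : ℝ}
    (hinsep : ¬ IsSeparableSet (contraction F (strictLevelSet w α)) (valueSet w α))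
    {i j : Fin p} (hi : i ∈ valueSet w α) (hj : j ∈ valueSet w α) :
    SameConstantSet F w i j := by
  have hunion : strictLevelSet w α ∪ valueSet w α = levelSet w α := by
    ext k
    simp only [strictLevelSet, valueSet, levelSet, Finset.mem_union, Finset.mem_filter,
      Finset.mem_univ, true_and, le_iff_lt_or_eq, eq_comm]
  have hdisj : Disjoint (strictLevelSet w α) (valueSet w α) := by
    rw [Finset.disjoint_left]
    intro k h1 h2
    simp only [strictLevelSet, valueSet, Finset.mem_filter, Finset.mem_univ, true_and] at h1 h2
    linarith
  set B := strictLevelSet w α with hB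
  set Q := valueSet w α with hQ
  have hBD : B ∈ assocLattice F w :=
    mem_assocLattice_of_isUpperFor hsub hempty huniv (isUpperFor_strictLevelSet w α)
  have hBQD : B ∪ Q ∈ assocLattice F w :=
    hunion ▸ mem_assocLattice_of_isUpperFor hsub hempty huniv (isUpperFor_levelSet w α)
  have key : ∀ A ∈ assocLattice F w, (A ∩ Q).Nonempty → (Q \ A).Nonempty → False := by
    intro A hA h1 h2
    refine hinsep ⟨A ∩ Q, Q \ A, h1, h2, ?_, ?_, ?_⟩
    · rw [Finset.disjoint_left]
      grind
    · grind
    have hBA : B ∪ A ∩ Q ∈ assocLattice F w := by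
      have h := (union_inter_mem_assocLattice hsub hBD
        (union_inter_mem_assocLattice hsub hA hBQD).2).1
      convert h using 1
      ext k
      simp only [Finset.mem_union, Finset.mem_inter]
      tauto
    -- Ranking Q \ A above A ∩ Q within the level set makes B ∪ (Q \ A) tight as well. With `B`, B ∪
    -- Q and B ∪ (A ∩ Q) already tight, additivity of `s` separates `Q`.
    obtain ⟨s, hs, ht⟩ := exists_greedy hsub hempty
      (fun k => toLex (w k, if k ∈ Q \ A then (1 : ℕ) else 0))
    have hsw : s ∈ exposedFace F w := (mem_exposedFace_iff hsub hempty huniv).2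
      ⟨hs, fun U hU => ht U fun a ha b hb => Prod.Lex.toLex_lt_toLex.2 (Or.inl (hU a ha b hb))⟩
    have htight : IsTight F s (B ∪ Q \ A) := by
      refine ht _ fun a ha b hb => Prod.Lex.toLex_lt_toLex.2 ?_
      simp only [hB, hQ, strictLevelSet, valueSet, Finset.mem_union, Finset.mem_sdiff,
        Finset.mem_filter, Finset.mem_univ, true_and] at ha hb ⊢
      push Not at hb
      rcases ha with ha | ha
      · exact Or.inl (hb.1.trans_lt ha)
      · rcases hb.1.eq_or_lt with h | h
        · right
          simp [ha.1, ha.2, h, hb.2 h]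
        · left
          simpa [ha.1] using h
    have e1 := hBD s hsw
    have e2 := hBQD s hsw
    have e3 := hBA s hsw
    have e4 : ∑ k ∈ B ∪ Q \ A, s k = F (B ∪ Q \ A) := htight
    rw [Finset.sum_union hdisj] at e2
    rw [Finset.sum_union (hdisj.mono_right Finset.inter_subset_right)] at e3
    rw [Finset.sum_union (hdisj.mono_right Finset.sdiff_subset)] at e4
    have e5 := Finset.sum_inter_add_sum_sdiff Q A fun k => s k
    rw [Finset.inter_comm] at e5
    simp only [contraction]
    linarith
  intro A hA
  by_contra hne
  by_cases hiA : i ∈ A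
  · have hjA : j ∉ A := fun h => hne (by simp [hiA, h])
    exact key A hA ⟨i, by simp [hiA, hi]⟩ ⟨j, by simp [hjA, hj]⟩
  · have hjA : j ∈ A := by
      by_contra h
      exact hne (by simp [hiA, h])
    exact key A hA ⟨j, by simp [hjA, hj]⟩ ⟨i, by simp [hiA, hi]⟩

theorem proposition4 {p : ℕ} (F : Finset (Fin p) → ℝ)
    (hsub : IsSubmodular F) (hnonneg : ∀ A, 0 ≤ F A)
    (hempty : F ∅ = 0) (huniv : F Finset.univ = 0)
    (hagglo : ∀ A B : Finset (Fin p), Disjoint A B → ¬ IsSeparableSet (contraction F B) A →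
      ∀ C ⊆ A, (C.card : ℝ) / (A.card : ℝ) * (F (B ∪ A) - F B) ≤ F (B ∪ C) - F B)
    (z : EuclideanSpace ℝ (Fin p)) :
    (∀ lam : ℝ, 0 ≤ lam → ∃! w, IsProxSolution F z lam w) ∧
    ∀ mu lam : ℝ, 0 ≤ mu → mu ≤ lam →
      ∀ u v : EuclideanSpace ℝ (Fin p), IsProxSolution F z mu u → IsProxSolution F z lam v →
        (∀ i j : Fin p, SameConstantSet F u i j → SameConstantSet F v i j ∧ v i = v j) ∧
        (∀ α : ℝ, ¬ IsSeparableSet (contraction F (strictLevelSet u α)) (valueSet u α) →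
          ∀ i ∈ valueSet u α, ∀ j ∈ valueSet u α, SameConstantSet F v i j ∧ v i = v j) := by
  refine ⟨fun lam hlam => existsUnique_isProxSolution hsub hempty huniv z hlam, ?_⟩
  intro mu lam hmu hmulam u v hu hv
  have hlam := hmu.trans hmulam
  have hface := exposedFace_subset_of_isProxPoint hsub hempty huniv hagglo hmu hmulam
    ((isProxSolution_iff_isProxPoint hsub hempty huniv hmu).1 hu)
    ((isProxSolution_iff_isProxPoint hsub hempty huniv hlam).1 hv)
  have key : ∀ i j, SameConstantSet F u i j → SameConstantSet F v i j ∧ v i = v j :=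
    fun i j h =>
      have h' : SameConstantSet F v i j := fun A hA => h A fun s hs => hA s (hface hs)
      ⟨h', h'.apply_eq hsub hempty huniv⟩
  exact ⟨key, fun α hinsep i hi j hj =>
    key i j (sameConstantSet_of_not_isSeparableSet hsub hempty huniv hinsep hi hj)⟩
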